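/- All rings are commutative with identity. Let $Z(R)$ be the set of zero-divisors of a ring $R$. Let $\mathbb{AG}(R)$ be the graph whose vertices are the nonzero ideals $I$ of $R$ for which there is a nonzero ideal $J$ with $IJ=(0)$, two distinct vertices $I,J$ being adjacent if and only if $IJ=(0)$. Let $\Gamma(R)$ be the graph whose vertices are the nonzero elements of $Z(R)$, two distinct vertices $x,y$ being adjacent if and only if $xy=0$. The diameter of a graph is the supremum of the distances between its vertices ($\infty$ for two vertices not joined by a path; the empty graph has diameter $0$), and $K_2$ is the complete graph on two vertices. Let $R$ be a Noetherian ring with $\mathbb{AG}(R)\not\cong K_2$. Then the following conditions are equivalent: 1. $\operatorname{diam}(\mathbb{AG}(R))=2$. 2. $\operatorname{diam}(\mathbb{AG}(R[x]))=2$. 3. $\operatorname{diam}(\mathbb{AG}(R[x_1,\dots,x_n]))=2$ for all $n>0$. 4. $\operatorname{diam}(\mathbb{AG}(R[[x]]))=2$. 5. $\operatorname{diam}(\Gamma(R))=2$. 6. $\operatorname{diam}(\Gamma(R[x]))=2$. 7. $\operatorname{diam}(\Gamma(R[x_1,\dots,x_n]))=2$ for all $n>0$. 8. $\operatorname{diam}(\Gamma(R[[x]]))=2$.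 9. Either $Z(R)=P_1\cup P_2$ for two distinct prime ideals $P_1,P_2$ with $P_1\cap P_2=(0)$, or $Z(R)$ is a prime ideal with $Z(R)^2\neq(0)$. -/

import Mathlib

/-- The set `Z(R)` of zero-divisors of a commutative ring `R`
(it contains `0` as soon as `R` is nontrivial). -/
def zeroDivisorSet (R : Type*) [CommRing R] : Set R :=
  {x | ∃ y : R, y ≠ 0 ∧ x * y = 0}

/-- `I` is an annihilating-ideal: there is a nonzero ideal `J` with `I * J = 0`. -/
def IsAnnihilatingIdeal {R : Type*} [CommRing R] (I : Ideal R) : Prop :=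
  ∃ J : Ideal R, J ≠ ⊥ ∧ I * J = ⊥

/-- The annihilating-ideal graph `AG(R)`: its vertices are the nonzero annihilating-ideals of `R`,
and two distinct vertices are adjacent iff their product is zero. -/
def annihilatingIdealGraph (R : Type*) [CommRing R] :
    SimpleGraph {I : Ideal R // IsAnnihilatingIdeal I ∧ I ≠ ⊥} where
  Adj I J := I ≠ J ∧ (I : Ideal R) * (J : Ideal R) = ⊥
  symm := ⟨fun I J h => ⟨h.1.symm, by rw [mul_comm]; exact h.2⟩⟩
  loopless := ⟨fun _ h => h.1 rfl⟩

/-- The zero-divisor graph `Γ(R)`: its vertices are the nonzero zero-divisors of `R`,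
and two distinct vertices are adjacent iff their product is zero. -/
def zeroDivisorGraph (R : Type*) [CommRing R] :
    SimpleGraph {x : R // x ∈ zeroDivisorSet R ∧ x ≠ 0} where
  Adj x y := x ≠ y ∧ (x : R) * (y : R) = 0
  symm := ⟨fun x y h => ⟨h.1.symm, by rw [mul_comm]; exact h.2⟩⟩
  loopless := ⟨fun _ h => h.1 rfl⟩

/-! Diameter two, for either graph, gives: any two nonzero zero-divisors generate the same ideal,
have product zero, or share a nonzero annihilator; and some product of zero-divisors is nonzero. If
`Z(R)` is closed under addition it is then a prime ideal with nonzero square. Otherwise some `a + b`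
is regular, and the annihilators of `a` and `b` are primes meeting in zero
(`hasDisjointPrimes_of_add_notMem`).

Conversely, under condition 9, vertices with nonzero product have a common annihilator, since in a
Noetherian ring a single nonzero element kills an ideal of zero-divisors. So distances are at most
two, and a complete `AG(R)` would have to be `K₂`.

Condition 9 passes between `R` and a ring `S` with `R → S → R⟦X⟧` by McCoy's theorem: one nonzero
constant kills all coefficients of a zero-divisor. If `X` also lies in `S`, condition 9 makes
`AG(S)` infinite, so it is not `K₂`. -/

/-! ### McCoy's theorem for power series -/

-- With `a` the constant term of `f`, `a * g` has zero constant term, so it is `X * g₁` with `f * g₁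
-- = 0`. Coefficient `n` of `g₁` is `a` times coefficient `n + 1` of `g`; induct.
open PowerSeries in
theorem PowerSeries.pow_constantCoeff_mul_coeff_eq_zero {R : Type*} [CommRing R] {f : R⟦X⟧} (n : ℕ) :
    ∀ {g : R⟦X⟧}, f * g = 0 → constantCoeff f ^ (n + 1) * coeff n g = 0 := by
  induction n with
  | zero =>
    intro g h
    simpa using congrArg constantCoeff h
  | succ n ih =>
    intro g h
    have h0 : constantCoeff (C (constantCoeff f) * g) = 0 := by
      simpa using congrArg constantCoeff h
    obtain ⟨g₁, hg₁⟩ := X_dvd_iff.mpr h0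
    have h1 : f * g₁ = 0 := by
      apply X_mul_cancel
      linear_combination C (constantCoeff f) * h - f * hg₁
    have h2 := congrArg (coeff (n + 1)) hg₁
    rw [coeff_C_mul, coeff_succ_X_mul] at h2
    linear_combination ih h1 + constantCoeff f ^ (n + 1) * h2

-- The annihilators of the powers of `a` stabilise, so one power kills every coefficient of `g`. The
-- last power not killing `g` serves as `c`.
open PowerSeries in
theorem PowerSeries.exists_C_mul_ne_zero_of_mul_eq_zero {R : Type*} [CommRing R]
    [IsNoetherianRing R] {f g : R⟦X⟧} (h : f * g = 0) (hg : g ≠ 0) :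
    ∃ c : R, C c * g ≠ 0 ∧ C (constantCoeff f) * (C c * g) = 0 := by
  set a := constantCoeff f with ha
  let M : ℕ →o Ideal R :=
    ⟨fun n => LinearMap.ker (LinearMap.lsmul R R (a ^ n)), by
      refine monotone_nat_of_le_succ fun n x hx => ?_
      simp only [LinearMap.mem_ker, LinearMap.lsmul_apply, smul_eq_mul] at hx ⊢
      linear_combination a * hx⟩
  have hM (n : ℕ) (x : R) : x ∈ M n ↔ a ^ n * x = 0 := by simp [M]
  obtain ⟨N, hN⟩ := WellFoundedGT.monotone_chain_condition M
  have hkill : C (a ^ N) * g = 0 := by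
    ext n
    rw [coeff_C_mul, map_zero, ← hM, hN (max N (n + 1)) (le_max_left _ _)]
    exact M.monotone (le_max_right _ _)
      ((hM _ _).mpr (pow_constantCoeff_mul_coeff_eq_zero n h))
  classical
  have hex : ∃ n, C (a ^ n) * g = 0 := ⟨N, hkill⟩
  obtain ⟨m, hm⟩ : ∃ m, Nat.find hex = m + 1 := by
    refine Nat.exists_eq_succ_of_ne_zero fun h0 => hg ?_
    have := Nat.find_spec hex
    rw [h0] at this
    simpa using this
  refine ⟨a ^ m, Nat.find_min hex (by omega), ?_⟩
  have := Nat.find_spec hex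
  rw [hm, pow_succ, map_mul] at this
  linear_combination this

-- Once the constant term of `f` kills `c * g`, so does the shifted series `(f - f₀) / X`; repeat
-- `j` times.
open PowerSeries in
theorem PowerSeries.exists_C_mul_ne_zero_forall_coeff {R : Type*} [CommRing R]
    [IsNoetherianRing R] (j : ℕ) : ∀ {f g : R⟦X⟧}, f * g = 0 → g ≠ 0 →
    ∃ c : R, C c * g ≠ 0 ∧ ∀ i < j, C (coeff i f) * (C c * g) = 0 := by
  induction j with
  | zero => exact fun _ hg => ⟨1, by simpa using hg, by simp⟩
  | succ j ih =>
    intro f g h hg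
    obtain ⟨c, hc, hc0⟩ := exists_C_mul_ne_zero_of_mul_eq_zero h hg
    have hf := eq_X_mul_shift_add_const f
    set f₁ : R⟦X⟧ := PowerSeries.mk fun p => coeff (p + 1) f with hf₁
    have h1 : f₁ * (C c * g) = 0 := by
      apply X_mul_cancel
      linear_combination C c * h - (C c * g) * hf - hc0
    obtain ⟨d, hd, hd0⟩ := ih h1 hc
    refine ⟨d * c, by simpa [mul_assoc] using hd, fun i hi => ?_⟩
    rcases i with - | i
    · rw [map_mul, coeff_zero_eq_constantCoeff_apply]
      linear_combination C d * hc0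
    · have := hd0 i (by omega)
      rw [hf₁, coeff_mk] at this
      rw [map_mul]
      linear_combination this

open PowerSeries in
/-- McCoy's theorem for power series over a Noetherian ring. -/
theorem PowerSeries.exists_ne_zero_forall_mul_coeff_eq_zero {R : Type*} [CommRing R]
    [IsNoetherianRing R] {f g : R⟦X⟧} (h : f * g = 0) (hg : g ≠ 0) :
    ∃ r : R, r ≠ 0 ∧ ∀ n, coeff n f * r = 0 := by
  let M : ℕ →o Ideal R :=
    ⟨fun n => Ideal.span ((fun i => coeff i f) '' Set.Iio n), fun m n hmn =>
      Ideal.span_mono (Set.image_mono (Set.Iio_subset_Iio hmn))⟩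
  obtain ⟨N, hN⟩ := WellFoundedGT.monotone_chain_condition M
  obtain ⟨c, hc, hc0⟩ := exists_C_mul_ne_zero_forall_coeff N h hg
  obtain ⟨k, hk⟩ : ∃ k, coeff k (C c * g) ≠ 0 := by
    by_contra! hz
    exact hc (by ext n; simpa using hz n)
  refine ⟨_, hk, fun n => ?_⟩
  -- The first `N` coefficients of `f` generate the ideal of all of them, so it suffices that those
  -- are killed.
  have hle : M N ≤ LinearMap.ker (LinearMap.lsmul R R (coeff k (C c * g))) := by
    refine Ideal.span_le.mpr ?_
    rintro _ ⟨i, hi, rfl⟩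
    have := congrArg (coeff k) (hc0 i hi)
    rw [coeff_C_mul, map_zero] at this
    rw [SetLike.mem_coe, LinearMap.mem_ker, LinearMap.lsmul_apply, smul_eq_mul]
    linear_combination this
  have hmem : coeff n f ∈ M N := by
    rw [hN (max N (n + 1)) (le_max_left _ _)]
    exact M.monotone (le_max_right _ _) (Ideal.subset_span ⟨n, by simp, rfl⟩)
  have := hle hmem
  rw [LinearMap.mem_ker, LinearMap.lsmul_apply, smul_eq_mul] at this
  linear_combination this

/-! ### Condition 9 and ideals of zero-divisors -/

theorem Ideal.mul_eq_bot_iff_forall {R : Type*} [CommRing R] {I J : Ideal R} :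
    I * J = ⊥ ↔ ∀ a ∈ I, ∀ b ∈ J, a * b = 0 := by
  simp [← le_bot_iff, Ideal.mul_le]

theorem Ideal.exists_mul_ne_zero_of_mul_ne_bot {R : Type*} [CommRing R] {I J : Ideal R}
    (h : I * J ≠ ⊥) : ∃ a ∈ I, ∃ b ∈ J, a * b ≠ 0 := by
  by_contra! hc
  exact h (Ideal.mul_eq_bot_iff_forall.mpr hc)

/-- There are two nonzero prime ideals with zero intersection. -/
def HasDisjointPrimes (R : Type*) [CommRing R] : Prop :=
  ∃ P Q : Ideal R, P.IsPrime ∧ Q.IsPrime ∧ P ≠ ⊥ ∧ Q ≠ ⊥ ∧ P ⊓ Q = ⊥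

/-- The zero-divisors form a prime ideal whose square is nonzero. -/
def ZeroDivisorsPrimeSqNeBot (R : Type*) [CommRing R] : Prop :=
  ∃ P : Ideal R, P.IsPrime ∧ zeroDivisorSet R = (P : Set R) ∧ P ^ 2 ≠ ⊥

/-- The zero-divisors form either a union of two primes with zero intersection, or a prime
ideal whose square is nonzero. -/
def ZeroDivisorPrimeCondition (R : Type*) [CommRing R] : Prop :=
  HasDisjointPrimes R ∨ ZeroDivisorsPrimeSqNeBot R

section

variable {R : Type*} [CommRing R]

theorem eq_zero_of_mem_of_mem {P Q : Ideal R} (h : P ⊓ Q = ⊥) {x : R} (hP : x ∈ P)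
    (hQ : x ∈ Q) : x = 0 := by
  have : x ∈ P ⊓ Q := ⟨hP, hQ⟩
  rwa [h, Ideal.mem_bot] at this

theorem zeroDivisorSet_eq_union {P Q : Ideal R} [P.IsPrime] [Q.IsPrime] (hP : P ≠ ⊥)
    (hQ : Q ≠ ⊥) (h : P ⊓ Q = ⊥) : zeroDivisorSet R = (P : Set R) ∪ (Q : Set R) := by
  ext x
  constructor
  · rintro ⟨y, hy, hxy⟩
    by_contra hx
    simp only [Set.mem_union, SetLike.mem_coe, not_or] at hx
    have hyP : y ∈ P := (Ideal.IsPrime.mem_or_mem ‹_› (hxy ▸ P.zero_mem)).resolve_left hx.1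
    have hyQ : y ∈ Q := (Ideal.IsPrime.mem_or_mem ‹_› (hxy ▸ Q.zero_mem)).resolve_left hx.2
    exact hy (eq_zero_of_mem_of_mem h hyP hyQ)
  · rintro (hx | hx)
    · obtain ⟨y, hy, hy0⟩ := Submodule.exists_mem_ne_zero_of_ne_bot hQ
      exact ⟨y, hy0, eq_zero_of_mem_of_mem h (P.mul_mem_right _ hx) (Q.mul_mem_left _ hy)⟩
    · obtain ⟨y, hy, hy0⟩ := Submodule.exists_mem_ne_zero_of_ne_bot hP
      exact ⟨y, hy0, eq_zero_of_mem_of_mem h (P.mul_mem_left _ hy) (Q.mul_mem_right _ hx)⟩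

/-- If `P` were zero, `R` would be a domain, yet `Q` would contain a nonzero zero-divisor. -/
theorem ne_bot_of_zeroDivisorSet_eq_union {P Q : Ideal R} [P.IsPrime] (hPQ : P ≠ Q)
    (h : zeroDivisorSet R = (P : Set R) ∪ (Q : Set R)) : P ≠ ⊥ := by
  rintro rfl
  obtain ⟨q, hq, hq0⟩ := Submodule.exists_mem_ne_zero_of_ne_bot hPQ.symm
  obtain ⟨y, hy, hqy⟩ : q ∈ zeroDivisorSet R := h ▸ Or.inr hq
  rcases Ideal.IsPrime.mem_or_mem (I := (⊥ : Ideal R)) ‹_› (Ideal.mem_bot.mpr hqy) with h | h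
  · exact hq0 h
  · exact hy h

/-- Trading the description of `Z(R)` as a union for nonvanishing of the primes leaves a condition
on primes alone, which is easier to transport. -/
theorem zeroDivisorPrimeCondition_iff : ZeroDivisorPrimeCondition R ↔
    (∃ P Q : Ideal R, P.IsPrime ∧ Q.IsPrime ∧ P ≠ Q ∧
      zeroDivisorSet R = (P : Set R) ∪ (Q : Set R) ∧ P ⊓ Q = ⊥) ∨
    (∃ P : Ideal R, P.IsPrime ∧ zeroDivisorSet R = (P : Set R) ∧ P ^ 2 ≠ ⊥) := by
  refine or_congr ⟨?_, ?_⟩ Iff.rfl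
  · rintro ⟨P, Q, hP, hQ, hP0, hQ0, h⟩
    refine ⟨P, Q, hP, hQ, ?_, zeroDivisorSet_eq_union hP0 hQ0 h, h⟩
    rintro rfl
    exact hP0 (by simpa using h)
  · rintro ⟨P, Q, hP, hQ, hPQ, hZ, h⟩
    exact ⟨P, Q, hP, hQ, ne_bot_of_zeroDivisorSet_eq_union hPQ hZ,
      ne_bot_of_zeroDivisorSet_eq_union hPQ.symm (by rw [hZ, Set.union_comm]), h⟩

/-- Zero-divisors fill the union of the finitely many associated primes; by prime avoidance the
ideal lies in one of them. -/
theorem exists_forall_mul_eq_zero_of_subset_zeroDivisorSet [IsNoetherianRing R] {P : Ideal R}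
    (h : (P : Set R) ⊆ zeroDivisorSet R) : ∃ z : R, z ≠ 0 ∧ ∀ p ∈ P, p * z = 0 := by
  have hd : Disjoint (P : Set R) (nonZeroDivisors R) := by
    refine Set.disjoint_left.mpr fun x hx hx' => ?_
    obtain ⟨y, hy, hxy⟩ := h hx
    exact hy ((mem_nonZeroDivisors_iff_right.mp hx') y (by rw [mul_comm, hxy]))
  obtain ⟨z, hz, hz0⟩ := Submodule.exists_mem_ne_zero_of_ne_bot
    (Ideal.bot_lt_annihilator_of_disjoint_nonZeroDivisors hd).ne'
  refine ⟨z, hz0, fun p hp => ?_⟩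
  have := Submodule.mem_annihilator.mp hz p hp
  rwa [smul_eq_mul, mul_comm] at this

theorem Ideal.exists_mul_ne_zero_of_sq_ne_bot {P : Ideal R} (h : P ^ 2 ≠ ⊥) :
    ∃ a ∈ P, ∃ b ∈ P, a * b ≠ 0 :=
  Ideal.exists_mul_ne_zero_of_mul_ne_bot (pow_two P ▸ h)

end

/-! ### Transfer of condition 9 between `R` and rings inside `R⟦X⟧` -/

section Extension

open PowerSeries

variable {R S : Type*} [CommRing R] [CommRing S] {ι : R →+* S} {j : S →+* R⟦X⟧}

theorem injective_of_apply_eq_C (hι : ∀ r, j (ι r) = C r) : Function.Injective ι := fun a b h => by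
  have := congrArg (constantCoeff ∘ j) h
  simpa [hι] using this

/-- The elements of a subring of `R⟦X⟧` all of whose coefficients lie in `P`. -/
noncomputable def coeffIdeal (j : S →+* R⟦X⟧) (P : Ideal R) : Ideal S :=
  RingHom.ker ((PowerSeries.map (Ideal.Quotient.mk P)).comp j)

theorem mem_coeffIdeal {P : Ideal R} {f : S} : f ∈ coeffIdeal j P ↔ ∀ n, coeff n (j f) ∈ P := by
  simp [coeffIdeal, RingHom.mem_ker, PowerSeries.ext_iff, Ideal.Quotient.eq_zero_iff_mem]

instance (P : Ideal R) [P.IsPrime] : (coeffIdeal j P).IsPrime := by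
  unfold coeffIdeal
  exact RingHom.ker_isPrime _

theorem apply_mem_coeffIdeal (hι : ∀ r, j (ι r) = C r) {P : Ideal R} {a : R} (ha : a ∈ P) :
    ι a ∈ coeffIdeal j P := by
  rw [mem_coeffIdeal]
  intro n
  rw [hι, coeff_C]
  split_ifs
  · exact ha
  · exact P.zero_mem

theorem exists_ne_zero_of_mem_zeroDivisorSet [IsNoetherianRing R] (hj : Function.Injective j)
    {f : S} (hf : f ∈ zeroDivisorSet S) : ∃ r : R, r ≠ 0 ∧ ∀ n, coeff n (j f) * r = 0 := by
  obtain ⟨g, hg, hfg⟩ := hf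
  exact exists_ne_zero_forall_mul_coeff_eq_zero (g := j g) (by rw [← map_mul, hfg, map_zero])
    ((map_ne_zero_iff j hj).mpr hg)

theorem coeff_mem_zeroDivisorSet [IsNoetherianRing R] (hj : Function.Injective j)
    {f : S} (hf : f ∈ zeroDivisorSet S) (n : ℕ) : coeff n (j f) ∈ zeroDivisorSet R :=
  let ⟨r, hr, h⟩ := exists_ne_zero_of_mem_zeroDivisorSet hj hf
  ⟨r, hr, h n⟩

theorem HasDisjointPrimes.extension (hj : Function.Injective j) (hι : ∀ r, j (ι r) = C r)
    (h : HasDisjointPrimes R) : HasDisjointPrimes S := by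
  obtain ⟨P, Q, hP, hQ, hP0, hQ0, h⟩ := h
  have key (I : Ideal R) (hI : I ≠ ⊥) : coeffIdeal j I ≠ ⊥ := by
    obtain ⟨a, ha, ha0⟩ := Submodule.exists_mem_ne_zero_of_ne_bot hI
    exact Submodule.ne_bot_iff _ |>.mpr ⟨ι a, apply_mem_coeffIdeal hι ha,
      (map_ne_zero_iff ι (injective_of_apply_eq_C hι)).mpr ha0⟩
  refine ⟨coeffIdeal j P, coeffIdeal j Q, inferInstance, inferInstance, key P hP0, key Q hQ0, ?_⟩
  rw [eq_bot_iff]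
  rintro f ⟨hf, hf'⟩
  refine hj (PowerSeries.ext fun n => ?_)
  simpa using eq_zero_of_mem_of_mem h (mem_coeffIdeal.mp hf n) (mem_coeffIdeal.mp hf' n)

/-- A prime contracting to zero would make `R` a domain, hence also `R⟦X⟧` and `S`, contradicting `P
* Q = ⊥`. -/
theorem HasDisjointPrimes.of_extension (hj : Function.Injective j) (hι : ∀ r, j (ι r) = C r)
    (h : HasDisjointPrimes S) : HasDisjointPrimes R := by
  obtain ⟨P, Q, hP, hQ, hP0, hQ0, h⟩ := h
  have hmul : P * Q = ⊥ := le_bot_iff.mp (h ▸ Ideal.mul_le_inf)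
  have hnd : ¬ IsDomain R := fun _ => by
    have : IsDomain S := hj.isDomain j
    rcases Ideal.mul_eq_bot.mp hmul with h | h
    exacts [hP0 h, hQ0 h]
  have hinf : P.comap ι ⊓ Q.comap ι = ⊥ := by
    rw [eq_bot_iff]
    rintro x ⟨hx, hx'⟩
    exact (map_eq_zero_iff ι (injective_of_apply_eq_C hι)).mp (eq_zero_of_mem_of_mem h hx hx')
  have key (I : Ideal S) (hI : I.IsPrime) : I.comap ι ≠ ⊥ := fun h0 => hnd <| by
    have := hI.comap ι
    rw [h0] at this
    exact IsDomain.of_bot_isPrime R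
  exact ⟨_, _, hP.comap ι, hQ.comap ι, key P hP, key Q hQ, hinf⟩

variable [IsNoetherianRing R]

/-- McCoy puts the coefficients of a zero-divisor in `P`; conversely one `z` kills `P`, hence every
series with coefficients in `P`. -/
theorem ZeroDivisorsPrimeSqNeBot.extension (hj : Function.Injective j)
    (hι : ∀ r, j (ι r) = C r) (h : ZeroDivisorsPrimeSqNeBot R) :
    ZeroDivisorsPrimeSqNeBot S := by
  obtain ⟨P, hP, hZ, h⟩ := h
  obtain ⟨z, hz, hPz⟩ := exists_forall_mul_eq_zero_of_subset_zeroDivisorSet hZ.ge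
  have hι' := injective_of_apply_eq_C hι
  refine ⟨coeffIdeal j P, inferInstance, ?_, ?_⟩
  · ext f
    refine ⟨fun hf => mem_coeffIdeal.mpr fun n => ?_, fun hf =>
      ⟨ι z, (map_ne_zero_iff ι hι').mpr hz, hj ?_⟩⟩
    · have := coeff_mem_zeroDivisorSet hj hf n
      rwa [hZ] at this
    · ext n
      rw [map_mul, hι, coeff_mul_C, hPz _ (mem_coeffIdeal.mp hf n), map_zero, map_zero]
  · obtain ⟨a, ha, b, hb, hab⟩ := Ideal.exists_mul_ne_zero_of_sq_ne_bot h
    intro h0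
    rw [pow_two, Ideal.mul_eq_bot_iff_forall] at h0
    refine hab (hι' ?_)
    simpa using h0 _ (apply_mem_coeffIdeal hι ha) _ (apply_mem_coeffIdeal hι hb)

/-- Coefficients of elements of `P` lie in its contraction; were the square of the contraction zero,
all products in `P` would vanish coefficientwise. -/
theorem ZeroDivisorsPrimeSqNeBot.of_extension (hj : Function.Injective j)
    (hι : ∀ r, j (ι r) = C r) (h : ZeroDivisorsPrimeSqNeBot S) :
    ZeroDivisorsPrimeSqNeBot R := by
  obtain ⟨P, hP, hZ, h⟩ := h
  have hZ' : zeroDivisorSet R = (P.comap ι : Set R) := by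
    ext a
    have : ι a ∈ zeroDivisorSet S ↔ ι a ∈ P := by rw [hZ]; rfl
    refine Iff.trans ⟨?_, ?_⟩ this
    · rintro ⟨y, hy, hay⟩
      exact ⟨ι y, (map_ne_zero_iff ι (injective_of_apply_eq_C hι)).mpr hy,
        by rw [← map_mul, hay, map_zero]⟩
    · intro ha
      simpa [hι] using coeff_mem_zeroDivisorSet hj ha 0
  refine ⟨_, hP.comap ι, hZ', fun h0 => ?_⟩
  obtain ⟨f, hf, g, hg, hfg⟩ := Ideal.exists_mul_ne_zero_of_sq_ne_bot h
  rw [pow_two, Ideal.mul_eq_bot_iff_forall] at h0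
  refine hfg (hj ?_)
  have hmem {f : S} (hf : f ∈ P) (n : ℕ) : coeff n (j f) ∈ P.comap ι := by
    have : f ∈ zeroDivisorSet S := hZ ▸ hf
    have := coeff_mem_zeroDivisorSet hj this n
    rwa [hZ'] at this
  ext n
  rw [map_mul, coeff_mul, map_zero, map_zero]
  exact Finset.sum_eq_zero fun p _ => h0 _ (hmem hf p.1) _ (hmem hg p.2)

theorem zeroDivisorPrimeCondition_extension_iff (hj : Function.Injective j)
    (hι : ∀ r, j (ι r) = C r) : ZeroDivisorPrimeCondition S ↔ ZeroDivisorPrimeCondition R :=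
  ⟨Or.imp (.of_extension hj hι) (.of_extension hj hι), Or.imp (.extension hj hι) (.extension hj hι)⟩

theorem zeroDivisorPrimeCondition_powerSeries_iff :
    ZeroDivisorPrimeCondition R⟦X⟧ ↔ ZeroDivisorPrimeCondition R :=
  zeroDivisorPrimeCondition_extension_iff (ι := C) (j := RingHom.id _) Function.injective_id
    fun _ => rfl

theorem zeroDivisorPrimeCondition_polynomial_iff :
    ZeroDivisorPrimeCondition (Polynomial R) ↔ ZeroDivisorPrimeCondition R :=
  zeroDivisorPrimeCondition_extension_iff (ι := Polynomial.C)
    (j := Polynomial.coeToPowerSeries.ringHom) (Polynomial.coe_injective R) fun _ => by simp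

theorem zeroDivisorPrimeCondition_congr (e : R ≃+* S) :
    ZeroDivisorPrimeCondition S ↔ ZeroDivisorPrimeCondition R :=
  zeroDivisorPrimeCondition_extension_iff (ι := (e : R →+* S)) (j := C.comp (e.symm : S →+* R))
    -- An isomorphic copy of `R` sits in `R⟦X⟧` as the constants.
    (C_injective.comp e.symm.injective) fun _ => by simp

theorem zeroDivisorPrimeCondition_mvPolynomial_iff (n : ℕ) :
    ZeroDivisorPrimeCondition (MvPolynomial (Fin n) R) ↔ ZeroDivisorPrimeCondition R := by
  induction n with
  | zero =>
    exact zeroDivisorPrimeCondition_congr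
      (MvPolynomial.isEmptyAlgEquiv R (Fin 0)).toRingEquiv.symm
  | succ n ih =>
    rw [zeroDivisorPrimeCondition_congr (MvPolynomial.finSuccEquiv R n).toRingEquiv.symm,
      zeroDivisorPrimeCondition_polynomial_iff, ih]

end Extension

/-! ### Graphs of diameter two -/

theorem SimpleGraph.ediam_eq_two_iff {V : Type*} (G : SimpleGraph V) : G.ediam = 2 ↔
    (∀ u v, u ≠ v → ¬ G.Adj u v → ∃ w, G.Adj u w ∧ G.Adj w v) ∧
      ∃ u v, u ≠ v ∧ ¬ G.Adj u v := by
  constructor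
  · intro h
    refine ⟨fun u v huv hadj => ?_, ?_⟩
    · by_contra! hc
      refine (G.edist_le_ediam (u := u) (v := v)).not_gt (h ▸ two_lt_edist_iff.mpr
        ⟨huv, hadj, Set.eq_empty_iff_forall_notMem.mpr fun w hw => ?_⟩)
      rw [mem_commonNeighbors] at hw
      exact hc w hw.1 hw.2.symm
    · by_contra! hc
      have : G.ediam ≤ 1 := ediam_le_of_edist_le fun u v => by
        rw [edist_le_one_iff_adj_or_eq]
        by_cases huv : u = v
        exacts [Or.inr huv, Or.inl (hc u v huv)]
      rw [h] at this
      exact absurd this (by decide)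
  · rintro ⟨h, u, v, huv, hadj⟩
    refine le_antisymm (ediam_le_of_edist_le fun u v => not_lt.mp fun hlt => ?_) ?_
    · obtain ⟨hne, hn, he⟩ := two_lt_edist_iff.mp hlt
      obtain ⟨w, hw, hw'⟩ := h u v hne hn
      exact Set.eq_empty_iff_forall_notMem.mp he w ((mem_commonNeighbors _).mpr ⟨hw, hw'.symm⟩)
    · obtain ⟨w, hw, hw'⟩ := h u v huv hadj
      rw [← edist_eq_two_iff.mpr ⟨huv, hadj, w, (mem_commonNeighbors _).mpr ⟨hw, hw'.symm⟩⟩]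
      exact edist_le_ediam

theorem SimpleGraph.nonempty_iso_top_fin_two {V : Type*} (G : SimpleGraph V) {u v : V}
    (huv : G.Adj u v) (h : ∀ w, w = u ∨ w = v) :
    Nonempty (G ≃g (⊤ : SimpleGraph (Fin 2))) := by
  have hne := huv.ne
  have hinj : Function.Injective ![u, v] := by
    intro a b
    fin_cases a <;> fin_cases b <;> simp [hne, hne.symm]
  have hsurj : Function.Surjective ![u, v] := fun w => by
    rcases h w with rfl | rfl
    exacts [⟨0, rfl⟩, ⟨1, rfl⟩]
  refine ⟨(RelIso.mk (Equiv.ofBijective _ ⟨hinj, hsurj⟩) ?_).symm⟩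
  intro a b
  change G.Adj (![u, v] a) (![u, v] b) ↔ _
  fin_cases a <;> fin_cases b <;> simp [huv, huv.symm]

/-! ### Diameter two implies condition 9 -/

section

variable {R : Type*} [CommRing R]

theorem mul_mem_zeroDivisorSet_right {x : R} (hx : x ∈ zeroDivisorSet R) (r : R) :
    r * x ∈ zeroDivisorSet R :=
  let ⟨y, hy, hxy⟩ := hx
  ⟨y, hy, by rw [mul_assoc, hxy, mul_zero]⟩

theorem IsAnnihilatingIdeal.mem_zeroDivisorSet {I : Ideal R} (hI : IsAnnihilatingIdeal I) {x : R}
    (hx : x ∈ I) : x ∈ zeroDivisorSet R := by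
  obtain ⟨J, hJ, hIJ⟩ := hI
  obtain ⟨y, hy, hy0⟩ := Submodule.exists_mem_ne_zero_of_ne_bot hJ
  exact ⟨y, hy0, Ideal.mul_eq_bot_iff_forall.mp hIJ x hx y hy⟩

theorem isAnnihilatingIdeal_iff {I : Ideal R} :
    IsAnnihilatingIdeal I ↔ ∃ y : R, y ≠ 0 ∧ ∀ x ∈ I, x * y = 0 := by
  constructor
  · rintro ⟨J, hJ, hIJ⟩
    obtain ⟨y, hy, hy0⟩ := Submodule.exists_mem_ne_zero_of_ne_bot hJ
    exact ⟨y, hy0, fun x hx => Ideal.mul_eq_bot_iff_forall.mp hIJ x hx y hy⟩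
  · rintro ⟨y, hy, h⟩
    refine ⟨Ideal.span {y}, by simpa using hy, Ideal.mul_eq_bot_iff_forall.mpr fun x hx b hb => ?_⟩
    obtain ⟨c, rfl⟩ := Ideal.mem_span_singleton'.mp hb
    rw [mul_left_comm, h x hx, mul_zero]

theorem isAnnihilatingIdeal_span_singleton {x : R} (hx : x ∈ zeroDivisorSet R) :
    IsAnnihilatingIdeal (Ideal.span {x}) := by
  obtain ⟨y, hy, hxy⟩ := hx
  refine isAnnihilatingIdeal_iff.mpr ⟨y, hy, fun a ha => ?_⟩
  obtain ⟨c, rfl⟩ := Ideal.mem_span_singleton'.mp ha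
  rw [mul_assoc, hxy, mul_zero]

/-- If any two nonzero zero-divisors are associated, orthogonal or have a common annihilator,
then two zero-divisors with regular sum force two nonzero primes with zero intersection. -/
theorem hasDisjointPrimes_of_add_notMem
    (h : ∀ x ∈ zeroDivisorSet R, ∀ y ∈ zeroDivisorSet R, x ≠ 0 → y ≠ 0 →
      Ideal.span {x} = Ideal.span {y} ∨ x * y = 0 ∨ ∃ z ≠ 0, x * z = 0 ∧ y * z = 0)
    {a b : R} (ha : a ∈ zeroDivisorSet R) (hb : b ∈ zeroDivisorSet R)
    (hab : a + b ∉ zeroDivisorSet R) : HasDisjointPrimes R := by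
  have reg (z : R) (hz : (a + b) * z = 0) : z = 0 := by
    by_contra hz0
    exact hab ⟨z, hz0, hz⟩
  have ha0 : a ≠ 0 := by rintro rfl; exact hab (by simpa using hb)
  have hb0 : b ≠ 0 := by rintro rfl; exact hab (by simpa using ha)
  -- The other alternatives fail: `b = c * a` makes `a + b` a multiple of `a`, and a common
  -- annihilator kills `a + b`.
  have hmul : a * b = 0 := by
    rcases h a ha b hb ha0 hb0 with h | h | ⟨z, hz, haz, hbz⟩
    · have hba : b ∈ Ideal.span {a} := h ▸ Ideal.mem_span_singleton_self b
      obtain ⟨c, rfl⟩ := Ideal.mem_span_singleton'.mp hba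
      refine absurd ?_ hab
      have := mul_mem_zeroDivisorSet_right ha (1 + c)
      rwa [add_mul, one_mul] at this
    · exact h
    · exact absurd (reg z (by rw [add_mul, haz, hbz, add_zero])) hz
  have key {a b : R} (ha : a ∈ zeroDivisorSet R) (ha0 : a ≠ 0) (hb0 : b ≠ 0) (hmul : a * b = 0)
      (reg : ∀ z : R, (a + b) * z = 0 → z = 0) :
      Ideal.IsPrime (LinearMap.ker (LinearMap.mulLeft R a)) := by
    have hbb : b * b ≠ 0 := fun h0 => hb0 (reg b (by rw [add_mul, hmul, h0, add_zero]))
    refine ⟨fun htop => ha0 ?_, fun {u v} huv => ?_⟩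
    · have : (1 : R) ∈ (LinearMap.ker (LinearMap.mulLeft R a) : Ideal R) := htop ▸ trivial
      simpa using this
    · simp only [LinearMap.mem_ker, LinearMap.mulLeft_apply] at huv ⊢
      by_contra! hc
      obtain ⟨hu, hv⟩ := hc
      -- Testing `a` against `u * a + b` leaves only `a * (u * a + b) = 0`, so `a + b` kills `a *
      -- u`. Equal ideals would give `b * b = 0`, and a common annihilator would kill `b` too.
      have hy : u * a + b ∈ zeroDivisorSet R :=
        ⟨a * v, hv, by linear_combination a * huv + v * hmul⟩
      have hy0 : u * a + b ≠ 0 := fun h0 => hbb (by linear_combination b * h0 - u * hmul)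
      refine hu (reg _ ?_)
      rcases h a ha _ hy ha0 hy0 with h | h | ⟨z, hz, haz, hyz⟩
      · have hya : u * a + b ∈ Ideal.span {a} := h ▸ Ideal.mem_span_singleton_self _
        obtain ⟨c, hc⟩ := Ideal.mem_span_singleton'.mp hya
        exact absurd (by linear_combination (c - u) * hmul - b * hc) hbb
      · linear_combination h + (u - 1) * hmul
      · exact absurd (reg z (by linear_combination (1 - u) * haz + hyz)) hz
  refine ⟨_, _, key ha ha0 hb0 hmul reg,
    key hb hb0 ha0 (by rw [mul_comm, hmul]) (by rwa [add_comm b a]), ?_, ?_, ?_⟩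
  · exact Submodule.ne_bot_iff _ |>.mpr ⟨b, by simpa using hmul, hb0⟩
  · exact Submodule.ne_bot_iff _ |>.mpr ⟨a, by simpa [mul_comm] using hmul, ha0⟩
  · rw [eq_bot_iff]
    rintro x ⟨hx, hx'⟩
    simp only [SetLike.mem_coe, LinearMap.mem_ker, LinearMap.mulLeft_apply] at hx hx'
    exact reg x (by rw [add_mul, hx, hx', add_zero])

theorem zeroDivisorPrimeCondition_of_forall
    (h : ∀ x ∈ zeroDivisorSet R, ∀ y ∈ zeroDivisorSet R, x ≠ 0 → y ≠ 0 →
      Ideal.span {x} = Ideal.span {y} ∨ x * y = 0 ∨ ∃ z ≠ 0, x * z = 0 ∧ y * z = 0)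
    {a b : R} (ha : a ∈ zeroDivisorSet R) (hb : b ∈ zeroDivisorSet R) (hab : a * b ≠ 0) :
    ZeroDivisorPrimeCondition R := by
  by_cases hadd : ∀ x ∈ zeroDivisorSet R, ∀ y ∈ zeroDivisorSet R, x + y ∈ zeroDivisorSet R
  · right
    -- For primality: if `z` is killed by `x * y`, then `y` kills `z` or `x` kills the nonzero `y *
    -- z`.
    let P : Ideal R :=
      { carrier := zeroDivisorSet R
        add_mem' := fun hx hy => hadd _ hx _ hy
        zero_mem' := ⟨a * b, hab, zero_mul _⟩
        smul_mem' := fun r x hx => mul_mem_zeroDivisorSet_right hx r }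
    refine ⟨P, ⟨fun htop => ?_, fun {x y} hxy => ?_⟩, rfl, fun h0 => ?_⟩
    · obtain ⟨y, hy, h1⟩ : (1 : R) ∈ P := htop ▸ trivial
      exact hy (by simpa using h1)
    · obtain ⟨z, hz, h1⟩ := hxy
      by_cases hyz : y * z = 0
      · exact Or.inr ⟨z, hz, hyz⟩
      · exact Or.inl ⟨y * z, hyz, by rw [← mul_assoc, h1]⟩
    · rw [pow_two, Ideal.mul_eq_bot_iff_forall] at h0
      exact hab (h0 a ha b hb)
  · push Not at hadd
    obtain ⟨x, hx, y, hy, hxy⟩ := hadd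
    exact Or.inl (hasDisjointPrimes_of_add_notMem h hx hy hxy)

theorem zeroDivisorPrimeCondition_of_ediam_zeroDivisorGraph
    (h : (zeroDivisorGraph R).ediam = 2) : ZeroDivisorPrimeCondition R := by
  obtain ⟨h, ⟨a, ha⟩, ⟨b, hb⟩, hne, hadj⟩ := (SimpleGraph.ediam_eq_two_iff _).mp h
  refine zeroDivisorPrimeCondition_of_forall (fun x hx y hy hx0 hy0 => ?_) ha.1 hb.1
    fun h0 => hadj ⟨hne, h0⟩
  by_cases hxy : x = y
  · exact Or.inl (by rw [hxy])
  by_cases hmul : x * y = 0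
  · exact Or.inr (Or.inl hmul)
  obtain ⟨⟨z, hz⟩, hxz, hzy⟩ := h ⟨x, hx, hx0⟩ ⟨y, hy, hy0⟩ (by simpa using hxy)
    fun hadj => hmul hadj.2
  exact Or.inr (Or.inr ⟨z, hz.2, hxz.2, by rw [mul_comm]; exact hzy.2⟩)

theorem zeroDivisorPrimeCondition_of_ediam_annihilatingIdealGraph
    (h : (annihilatingIdealGraph R).ediam = 2) : ZeroDivisorPrimeCondition R := by
  obtain ⟨h, ⟨I, hI⟩, ⟨J, hJ⟩, hne, hadj⟩ := (SimpleGraph.ediam_eq_two_iff _).mp h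
  obtain ⟨a, ha, b, hb, hab⟩ :=
    Ideal.exists_mul_ne_zero_of_mul_ne_bot fun h0 => hadj ⟨hne, h0⟩
  refine zeroDivisorPrimeCondition_of_forall (fun x hx y hy hx0 hy0 => ?_)
    (hI.1.mem_zeroDivisorSet ha) (hJ.1.mem_zeroDivisorSet hb) hab
  by_cases hxy : Ideal.span {x} = Ideal.span {y}
  · exact Or.inl hxy
  by_cases hmul : x * y = 0
  · exact Or.inr (Or.inl hmul)
  obtain ⟨⟨K, hK⟩, hxK, hKy⟩ := h
    ⟨Ideal.span {x}, isAnnihilatingIdeal_span_singleton hx, by simpa using hx0⟩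
    ⟨Ideal.span {y}, isAnnihilatingIdeal_span_singleton hy, by simpa using hy0⟩
    (by simpa using hxy) fun hadj => hmul (Ideal.mul_eq_bot_iff_forall.mp hadj.2 _
      (Ideal.mem_span_singleton_self x) _ (Ideal.mem_span_singleton_self y))
  obtain ⟨z, hz, hz0⟩ := Submodule.exists_mem_ne_zero_of_ne_bot hK.2
  refine Or.inr (Or.inr ⟨z, hz0, Ideal.mul_eq_bot_iff_forall.mp hxK.2 _
      (Ideal.mem_span_singleton_self x) _ hz, ?_⟩)
  rw [mul_comm]
  exact Ideal.mul_eq_bot_iff_forall.mp hKy.2 _ hz _ (Ideal.mem_span_singleton_self y)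

/-- Ideals of zero-divisors with nonzero product have a common nonzero annihilator. -/
theorem ZeroDivisorPrimeCondition.exists_common_annihilator [IsNoetherianRing R]
    (h : ZeroDivisorPrimeCondition R) {I J : Ideal R} (hI : IsAnnihilatingIdeal I)
    (hJ : IsAnnihilatingIdeal J) (hIJ : I * J ≠ ⊥) :
    ∃ z : R, z ≠ 0 ∧ (∀ x ∈ I, x * z = 0) ∧ ∀ x ∈ J, x * z = 0 := by
  rcases h with ⟨P, Q, hP, hQ, hP0, hQ0, h⟩ | ⟨P, hP, hZ, h⟩
  · have hle {I : Ideal R} (hI : IsAnnihilatingIdeal I) : I ≤ P ∨ I ≤ Q := by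
      obtain ⟨y, hy, hIy⟩ := isAnnihilatingIdeal_iff.mp hI
      by_cases hyP : y ∈ P
      · exact Or.inr fun x hx => (hQ.mem_or_mem (hIy x hx ▸ Q.zero_mem)).resolve_right
          fun hyQ => hy (eq_zero_of_mem_of_mem h hyP hyQ)
      · exact Or.inl fun x hx => (hP.mem_or_mem (hIy x hx ▸ P.zero_mem)).resolve_right hyP
    obtain ⟨p, hp, hp0⟩ := Submodule.exists_mem_ne_zero_of_ne_bot hP0
    obtain ⟨q, hq, hq0⟩ := Submodule.exists_mem_ne_zero_of_ne_bot hQ0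
    have hPQ (x y : R) (hx : x ∈ P) (hy : y ∈ Q) : x * y = 0 :=
      eq_zero_of_mem_of_mem h (P.mul_mem_right _ hx) (Q.mul_mem_left _ hy)
    rcases hle hI with hI | hI <;> rcases hle hJ with hJ | hJ
    · exact ⟨q, hq0, fun x hx => hPQ x q (hI hx) hq, fun x hx => hPQ x q (hJ hx) hq⟩
    · exact absurd (Ideal.mul_eq_bot_iff_forall.mpr fun x hx y hy => hPQ x y (hI hx) (hJ hy)) hIJ
    · exact absurd (Ideal.mul_eq_bot_iff_forall.mpr fun x hx y hy =>
        (mul_comm x y).trans (hPQ y x (hJ hy) (hI hx))) hIJ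
    · exact ⟨p, hp0, fun x hx => (mul_comm x p).trans (hPQ p x hp (hI hx)),
        fun x hx => (mul_comm x p).trans (hPQ p x hp (hJ hx))⟩
  · obtain ⟨z, hz, hPz⟩ := exists_forall_mul_eq_zero_of_subset_zeroDivisorSet hZ.ge
    have hle {I : Ideal R} (hI : IsAnnihilatingIdeal I) : I ≤ P := fun x hx => by
      rw [← SetLike.mem_coe, ← hZ]
      exact hI.mem_zeroDivisorSet hx
    exact ⟨z, hz, fun x hx => hPz x (hle hI hx), fun x hx => hPz x (hle hJ hx)⟩

end

/-! ### Condition 9 implies diameter two -/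

section

variable {R : Type*} [CommRing R]

theorem mul_eq_bot_of_forall_adj
    (hc : ∀ I J, I ≠ J → (annihilatingIdealGraph R).Adj I J) {I J : Ideal R}
    (hI : IsAnnihilatingIdeal I) (hJ : IsAnnihilatingIdeal J) (hne : I ≠ J) : I * J = ⊥ := by
  by_cases hI0 : I = ⊥
  · simp [hI0]
  by_cases hJ0 : J = ⊥
  · simp [hJ0]
  exact (hc ⟨I, hI, hI0⟩ ⟨J, hJ, hJ0⟩ (by simpa using hne)).2

/-- A vertex other than `P` and `Q` would annihilate both, hence lie in both and be zero. -/
theorem HasDisjointPrimes.nonempty_iso (h : HasDisjointPrimes R)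
    (hc : ∀ I J, I ≠ J → (annihilatingIdealGraph R).Adj I J) :
    Nonempty (annihilatingIdealGraph R ≃g (⊤ : SimpleGraph (Fin 2))) := by
  obtain ⟨P, Q, hP, hQ, hP0, hQ0, h⟩ := h
  have hPQ : P * Q = ⊥ := le_bot_iff.mp (h ▸ Ideal.mul_le_inf)
  have hPv : IsAnnihilatingIdeal P := ⟨Q, hQ0, hPQ⟩
  have hQv : IsAnnihilatingIdeal Q := ⟨P, hP0, by rw [mul_comm, hPQ]⟩
  have hne : P ≠ Q := by
    rintro rfl
    exact hP0 (by simpa using h)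
  refine SimpleGraph.nonempty_iso_top_fin_two _ (u := ⟨P, hPv, hP0⟩) (v := ⟨Q, hQv, hQ0⟩)
    ⟨by simpa using hne, hPQ⟩ ?_
  rintro ⟨I, hI, hI0⟩
  by_contra! hI'
  have h1 := mul_eq_bot_of_forall_adj hc hI hPv (by simpa using hI'.1)
  have h2 := mul_eq_bot_of_forall_adj hc hI hQv (by simpa using hI'.2)
  rw [Ideal.mul_eq_bot_iff_forall] at h1 h2
  obtain ⟨a, ha, ha0⟩ := Submodule.exists_mem_ne_zero_of_ne_bot hI0
  obtain ⟨p, hp, hp0⟩ := Submodule.exists_mem_ne_zero_of_ne_bot hP0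
  obtain ⟨q, hq, hq0⟩ := Submodule.exists_mem_ne_zero_of_ne_bot hQ0
  refine ha0 (eq_zero_of_mem_of_mem h ?_ ?_)
  · exact (hP.mem_or_mem (h2 a ha q hq ▸ P.zero_mem)).resolve_right
      fun hqP => hq0 (eq_zero_of_mem_of_mem h hqP hq)
  · exact (hQ.mem_or_mem (h1 a ha p hp ▸ Q.zero_mem)).resolve_right
      fun hpQ => hp0 (eq_zero_of_mem_of_mem h hp hpQ)

/-- Completeness forces any `x ∈ P` not killing `P` to generate it. So `P = (a)` with `a² ≠ 0` and
`a³ = 0`, and the only vertices are `(a)` and `(a²)`. -/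
theorem ZeroDivisorsPrimeSqNeBot.nonempty_iso [IsNoetherianRing R]
    (h : ZeroDivisorsPrimeSqNeBot R)
    (hc : ∀ I J, I ≠ J → (annihilatingIdealGraph R).Adj I J) :
    Nonempty (annihilatingIdealGraph R ≃g (⊤ : SimpleGraph (Fin 2))) := by
  obtain ⟨P, hP, hZ, h⟩ := h
  have hmem {x : R} : x ∈ zeroDivisorSet R ↔ x ∈ P := by rw [hZ]; rfl
  have hPv : IsAnnihilatingIdeal P :=
    isAnnihilatingIdeal_iff.mpr (exists_forall_mul_eq_zero_of_subset_zeroDivisorSet hZ.ge)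
  have hspan {x : R} (hx : x ∈ P) : IsAnnihilatingIdeal (Ideal.span {x}) :=
    isAnnihilatingIdeal_span_singleton (hmem.mpr hx)
  have hspanP {x y : R} (hx : x ∈ P) (hy : y ∈ P) (hxy : x * y ≠ 0) : Ideal.span {x} = P := by
    by_contra hne
    exact hxy (Ideal.mul_eq_bot_iff_forall.mp
      (mul_eq_bot_of_forall_adj hc (hspan hx) hPv hne) x (Ideal.mem_span_singleton_self x)
      y hy)
  obtain ⟨a, ha, b, hb, hab⟩ := Ideal.exists_mul_ne_zero_of_sq_ne_bot h
  have haP := hspanP ha hb hab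
  have hgen {x : R} (hx : x ∈ P) : ∃ r, r * a = x := by
    rwa [← haP, Ideal.mem_span_singleton'] at hx
  have haa : a * a ≠ 0 := fun h0 => by
    obtain ⟨r, rfl⟩ := hgen hb
    exact hab (by linear_combination r * h0)
  have haaP : a * a ∈ P := P.mul_mem_left a ha
  have hne : P ≠ Ideal.span {a * a} := fun hPa => by
    have : a ∈ Ideal.span {a * a} := hPa ▸ ha
    obtain ⟨r, hr⟩ := Ideal.mem_span_singleton'.mp this
    -- Here `a = r * a²`, so `a` is killed by `1 - r * a`.
    have h1 : 1 - r * a ∈ P := hmem.mp ⟨a, left_ne_zero_of_mul haa, by linear_combination -hr⟩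
    refine hP.ne_top ((Ideal.eq_top_iff_one P).mpr ?_)
    simpa using P.add_mem h1 (P.mul_mem_left r ha)
  have hadj : P * Ideal.span {a * a} = ⊥ := mul_eq_bot_of_forall_adj hc hPv (hspan haaP) hne
  have ha3 : a * (a * a) = 0 :=
    Ideal.mul_eq_bot_iff_forall.mp hadj a ha _ (Ideal.mem_span_singleton_self _)
  have hP0 : P ≠ ⊥ := by
    rintro rfl
    exact haa (by simpa using haaP)
  refine SimpleGraph.nonempty_iso_top_fin_two _ (u := ⟨P, hPv, hP0⟩)
    (v := ⟨Ideal.span {a * a}, hspan haaP, by simpa using haa⟩) ⟨by simpa using hne, hadj⟩ ?_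
  rintro ⟨J, hJ, hJ0⟩
  by_cases hJP : J = P
  · exact Or.inl (Subtype.ext hJP)
  right
  have hJmul := Ideal.mul_eq_bot_iff_forall.mp (mul_eq_bot_of_forall_adj hc hJ hPv hJP)
  -- Write `x = r * a`. As `J` kills `a`, `r` kills `a²`, so `r` is itself a multiple of `a`.
  have hJle {x : R} (hx : x ∈ J) : ∃ s, s * (a * a) = x := by
    obtain ⟨r, rfl⟩ := hgen (hmem.mp (hJ.mem_zeroDivisorSet hx))
    obtain ⟨s, rfl⟩ := hgen (hmem.mp ⟨a * a, haa, by simpa [mul_assoc] using hJmul _ hx a ha⟩)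
    exact ⟨s, by ring⟩
  refine Subtype.ext (le_antisymm (fun x hx => Ideal.mem_span_singleton'.mpr (hJle hx)) ?_)
  obtain ⟨x, hx, hx0⟩ := Submodule.exists_mem_ne_zero_of_ne_bot hJ0
  obtain ⟨s, rfl⟩ := hJle hx
  -- Since `s * a² ≠ 0`, the element `s * a` generates `P`; this recovers `a²` from `s * a²`.
  have hsa := hspanP (P.mul_mem_left s ha) ha (by rwa [mul_assoc])
  obtain ⟨t, ht⟩ := Ideal.mem_span_singleton'.mp (hsa.symm ▸ ha : a ∈ Ideal.span {s * a})
  have : a * a = t * (s * (a * a)) := by linear_combination -a * ht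
  rw [Ideal.span_singleton_le_iff_mem, this]
  exact J.mul_mem_left t hx

theorem ZeroDivisorPrimeCondition.ediam_annihilatingIdealGraph [IsNoetherianRing R]
    (h : ZeroDivisorPrimeCondition R)
    (hK2 : ¬ Nonempty (annihilatingIdealGraph R ≃g (⊤ : SimpleGraph (Fin 2)))) :
    (annihilatingIdealGraph R).ediam = 2 := by
  refine (SimpleGraph.ediam_eq_two_iff _).mpr ⟨?_, ?_⟩
  · rintro ⟨I, hI⟩ ⟨J, hJ⟩ hne hadj
    have hIJ : I * J ≠ ⊥ := fun h0 => hadj ⟨hne, h0⟩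
    obtain ⟨z, hz, hIz, hJz⟩ := h.exists_common_annihilator hI.1 hJ.1 hIJ
    have hspan {I : Ideal R} (hI : ∀ x ∈ I, x * z = 0) : I * Ideal.span {z} = ⊥ := by
      refine Ideal.mul_eq_bot_iff_forall.mpr fun x hx y hy => ?_
      obtain ⟨c, rfl⟩ := Ideal.mem_span_singleton'.mp hy
      rw [mul_left_comm, hI x hx, mul_zero]
    -- The midpoint `(z)` differs from `I` and `J`: equality with either would give `I * J = ⊥`.
    refine ⟨⟨Ideal.span {z}, ⟨I, hI.2, by rw [mul_comm, hspan hIz]⟩, by simpa using hz⟩,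
      ⟨fun heq => hIJ ?_, hspan hIz⟩, ⟨fun heq => hIJ ?_, by simpa [mul_comm] using hspan hJz⟩⟩
    · rw [mul_comm, Subtype.mk.inj heq, hspan hJz]
    · rw [← Subtype.mk.inj heq, hspan hIz]
  · by_contra! hc
    exact hK2 (h.elim (fun h => h.nonempty_iso hc) fun h => h.nonempty_iso hc)

/-- Only `a = b` is a problem. Then for `c ∈ I` outside `J`, either `c` or `a + c` is a partner
distinct from `a` with nonzero product. -/
theorem exists_not_adj_zeroDivisorGraph {I J : Ideal R} (hI : IsAnnihilatingIdeal I)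
    (hJ : IsAnnihilatingIdeal J) (hIJ : ¬ I ≤ J) (hmul : I * J ≠ ⊥) :
    ∃ x y, x ≠ y ∧ ¬ (zeroDivisorGraph R).Adj x y := by
  suffices ∃ x ∈ zeroDivisorSet R, ∃ y ∈ zeroDivisorSet R, x ≠ y ∧ x * y ≠ 0 by
    obtain ⟨x, hx, y, hy, hne, hxy⟩ := this
    exact ⟨⟨x, hx, left_ne_zero_of_mul hxy⟩, ⟨y, hy, right_ne_zero_of_mul hxy⟩,
      by simpa using hne, fun h => hxy h.2⟩
  obtain ⟨a, ha, b, hb, hab⟩ := Ideal.exists_mul_ne_zero_of_mul_ne_bot hmul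
  by_cases hne : a = b
  · subst hne
    obtain ⟨c, hc, hcJ⟩ := SetLike.not_le_iff_exists.mp hIJ
    have hca : c ≠ a := fun h => hcJ (h ▸ hb)
    by_cases hac : a * c = 0
    · have hc0 : c ≠ 0 := fun h => hcJ (h ▸ J.zero_mem)
      exact ⟨a, hI.mem_zeroDivisorSet ha, a + c, hI.mem_zeroDivisorSet (I.add_mem ha hc),
        by simpa using hc0, by rwa [mul_add, hac, add_zero]⟩
    · exact ⟨a, hI.mem_zeroDivisorSet ha, c, hI.mem_zeroDivisorSet hc, hca.symm, hac⟩
  · exact ⟨a, hI.mem_zeroDivisorSet ha, b, hJ.mem_zeroDivisorSet hb, hne, hab⟩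

theorem ZeroDivisorPrimeCondition.ediam_zeroDivisorGraph [IsNoetherianRing R]
    (h : ZeroDivisorPrimeCondition R)
    (hK2 : ¬ Nonempty (annihilatingIdealGraph R ≃g (⊤ : SimpleGraph (Fin 2)))) :
    (zeroDivisorGraph R).ediam = 2 := by
  refine (SimpleGraph.ediam_eq_two_iff _).mpr ⟨?_, ?_⟩
  · rintro ⟨x, hx⟩ ⟨y, hy⟩ hne hadj
    have hxy : x * y ≠ 0 := fun h0 => hadj ⟨hne, h0⟩
    obtain ⟨z, hz, hxz, hyz⟩ := h.exists_common_annihilator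
      (isAnnihilatingIdeal_span_singleton hx.1) (isAnnihilatingIdeal_span_singleton hy.1)
      fun h0 => hxy (Ideal.mul_eq_bot_iff_forall.mp h0 _ (Ideal.mem_span_singleton_self x) _
        (Ideal.mem_span_singleton_self y))
    replace hxz := hxz x (Ideal.mem_span_singleton_self x)
    replace hyz := hyz y (Ideal.mem_span_singleton_self y)
    refine ⟨⟨z, ⟨x, hx.2, by rw [mul_comm, hxz]⟩, hz⟩, ⟨fun heq => hxy ?_, hxz⟩,
      ⟨fun heq => hxy ?_, by simpa [mul_comm] using hyz⟩⟩
    · rw [mul_comm, Subtype.mk.inj heq, hyz]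
    · rw [← Subtype.mk.inj heq, hxz]
  · obtain ⟨-, ⟨I, hI⟩, ⟨J, hJ⟩, hne, hadj⟩ :=
      (SimpleGraph.ediam_eq_two_iff _).mp (h.ediam_annihilatingIdealGraph hK2)
    have hmul : I * J ≠ ⊥ := fun h0 => hadj ⟨hne, h0⟩
    by_cases hIJ : I ≤ J
    · exact exists_not_adj_zeroDivisorGraph hJ.1 hI.1
        (fun hJI => hne (Subtype.ext (le_antisymm hIJ hJI))) (by rwa [mul_comm])
    · exact exists_not_adj_zeroDivisorGraph hI.1 hJ.1 hIJ hmul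

theorem ZeroDivisorPrimeCondition.exists_ne_zero_mem (h : ZeroDivisorPrimeCondition R) :
    ∃ a ∈ zeroDivisorSet R, a ≠ 0 := by
  rcases h with ⟨P, Q, hP, hQ, hP0, hQ0, h⟩ | ⟨P, hP, hZ, h⟩
  · obtain ⟨p, hp, hp0⟩ := Submodule.exists_mem_ne_zero_of_ne_bot hP0
    exact ⟨p, (zeroDivisorSet_eq_union hP0 hQ0 h).ge (Or.inl hp), hp0⟩
  · obtain ⟨a, ha, b, hb, hab⟩ := Ideal.exists_mul_ne_zero_of_sq_ne_bot h
    exact ⟨a, hZ.ge ha, left_ne_zero_of_mul hab⟩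

/-! ### Excluding `K₂` for the extensions, and conclusion -/

-- For a nonzero zero-divisor `a`, the ideals generated by `tⁿ * a` are infinitely many distinct
-- vertices.
open PowerSeries in
theorem not_nonempty_iso_of_extension {S : Type*} [CommRing S] {ι : R →+* S} {j : S →+* R⟦X⟧}
    (hι : ∀ r, j (ι r) = C r) {t : S} (ht : j t = X)
    (h : ZeroDivisorPrimeCondition R) :
    ¬ Nonempty (annihilatingIdealGraph S ≃g (⊤ : SimpleGraph (Fin 2))) := by
  rintro ⟨e⟩
  obtain ⟨a, ⟨b, hb, hab⟩, ha0⟩ := h.exists_ne_zero_mem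
  have hι' := injective_of_apply_eq_C hι
  have hne (n : ℕ) : t ^ n * ι a ≠ 0 := fun h0 => ha0 <| by
    have := congrArg (coeff n ∘ j) h0
    simpa [hι, ht, coeff_X_pow_mul'] using this
  have hzd (n : ℕ) : t ^ n * ι a ∈ zeroDivisorSet S :=
    ⟨ι b, (map_ne_zero_iff ι hι').mpr hb, by rw [mul_assoc, ← map_mul, hab, map_zero, mul_zero]⟩
  let v (n : ℕ) : {I : Ideal S // IsAnnihilatingIdeal I ∧ I ≠ ⊥} :=
    ⟨Ideal.span {t ^ n * ι a}, isAnnihilatingIdeal_span_singleton (hzd n), by simpa using hne n⟩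
  have hlt {m n : ℕ} (hmn : m < n) : v m ≠ v n := fun heq => ha0 <| by
    have hmem : t ^ m * ι a ∈ Ideal.span {t ^ n * ι a} := by
      have hmn : Ideal.span {t ^ m * ι a} = Ideal.span {t ^ n * ι a} := Subtype.ext_iff.mp heq
      exact hmn ▸ Ideal.mem_span_singleton_self (t ^ m * ι a)
    obtain ⟨s, hs⟩ := Ideal.mem_span_singleton'.mp hmem
    -- Coefficient `m` of a multiple of `Xⁿ` vanishes as `m < n`, while that of `Xᵐ * a` is `a`.
    have := congrArg (coeff m ∘ j) hs
    simpa [hι, ht, coeff_X_pow_mul', mul_left_comm (j s), hmn.not_ge] using this.symm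
  have hinj : Function.Injective v := fun m n hmn => by
    rcases lt_trichotomy m n with h | h | h
    exacts [absurd hmn (hlt h), h, absurd hmn.symm (hlt h)]
  have := Infinite.of_injective _ (e.injective.comp hinj)
  exact not_finite (Fin 2)

/-- `K₂` is excluded only under condition 9, because for the extensions the exclusion uses the
nonzero zero-divisor this condition provides. -/
theorem ediam_annihilatingIdealGraph_eq_two_iff [IsNoetherianRing R]
    (hK2 : ZeroDivisorPrimeCondition R →
      ¬ Nonempty (annihilatingIdealGraph R ≃g (⊤ : SimpleGraph (Fin 2)))) :
    (annihilatingIdealGraph R).ediam = 2 ↔ ZeroDivisorPrimeCondition R :=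
  ⟨zeroDivisorPrimeCondition_of_ediam_annihilatingIdealGraph,
    fun h => h.ediam_annihilatingIdealGraph (hK2 h)⟩

theorem ediam_zeroDivisorGraph_eq_two_iff [IsNoetherianRing R]
    (hK2 : ZeroDivisorPrimeCondition R →
      ¬ Nonempty (annihilatingIdealGraph R ≃g (⊤ : SimpleGraph (Fin 2)))) :
    (zeroDivisorGraph R).ediam = 2 ↔ ZeroDivisorPrimeCondition R :=
  ⟨zeroDivisorPrimeCondition_of_ediam_zeroDivisorGraph,
    fun h => h.ediam_zeroDivisorGraph (hK2 h)⟩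

variable [IsNoetherianRing R]

theorem not_nonempty_iso_powerSeries (h : ZeroDivisorPrimeCondition (PowerSeries R)) :
    ¬ Nonempty (annihilatingIdealGraph (PowerSeries R) ≃g (⊤ : SimpleGraph (Fin 2))) :=
  not_nonempty_iso_of_extension (ι := PowerSeries.C) (j := RingHom.id _)
    (fun _ => rfl) (t := PowerSeries.X) rfl (zeroDivisorPrimeCondition_powerSeries_iff.mp h)

theorem not_nonempty_iso_polynomial (h : ZeroDivisorPrimeCondition (Polynomial R)) :
    ¬ Nonempty (annihilatingIdealGraph (Polynomial R) ≃g (⊤ : SimpleGraph (Fin 2))) :=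
  not_nonempty_iso_of_extension (ι := Polynomial.C) (j := Polynomial.coeToPowerSeries.ringHom)
    (fun _ => by simp) (t := Polynomial.X) (by simp)
    (zeroDivisorPrimeCondition_polynomial_iff.mp h)

theorem not_nonempty_iso_mvPolynomial {n : ℕ} (hn : 0 < n)
    (h : ZeroDivisorPrimeCondition (MvPolynomial (Fin n) R)) :
    ¬ Nonempty (annihilatingIdealGraph (MvPolynomial (Fin n) R) ≃g
      (⊤ : SimpleGraph (Fin 2))) := by
  obtain ⟨n, rfl⟩ := Nat.exists_eq_succ_of_ne_zero hn.ne'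
  -- One variable plays the role of `X` over the polynomial ring in the remaining `n`.
  let e := (MvPolynomial.finSuccEquiv R n).toRingEquiv
  refine not_nonempty_iso_of_extension (R := MvPolynomial (Fin n) R)
    (ι := (e.symm : _ →+* _).comp Polynomial.C)
    (j := Polynomial.coeToPowerSeries.ringHom.comp (e : _ →+* _))
    (fun _ => by simp) (t := e.symm Polynomial.X)
    (by simp) ?_
  rwa [zeroDivisorPrimeCondition_mvPolynomial_iff] at h ⊢

end

theorem theorem2p4 (R : Type*) [CommRing R] [IsNoetherianRing R]
    (hK2 : ¬ Nonempty (annihilatingIdealGraph R ≃g (⊤ : SimpleGraph (Fin 2)))) :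
    List.TFAE [
      (annihilatingIdealGraph R).ediam = 2,
      (annihilatingIdealGraph (Polynomial R)).ediam = 2,
      ∀ n : ℕ, 0 < n → (annihilatingIdealGraph (MvPolynomial (Fin n) R)).ediam = 2,
      (annihilatingIdealGraph (PowerSeries R)).ediam = 2,
      (zeroDivisorGraph R).ediam = 2,
      (zeroDivisorGraph (Polynomial R)).ediam = 2,
      ∀ n : ℕ, 0 < n → (zeroDivisorGraph (MvPolynomial (Fin n) R)).ediam = 2,
      (zeroDivisorGraph (PowerSeries R)).ediam = 2,
      (∃ P Q : Ideal R, P.IsPrime ∧ Q.IsPrime ∧ P ≠ Q ∧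
          zeroDivisorSet R = (P : Set R) ∪ (Q : Set R) ∧ P ⊓ Q = ⊥) ∨
        (∃ P : Ideal R, P.IsPrime ∧ zeroDivisorSet R = (P : Set R) ∧ P ^ 2 ≠ ⊥)] := by
  have hforall {p : ℕ → Prop} (h : ∀ n, 0 < n → (p n ↔ ZeroDivisorPrimeCondition R)) :
      (∀ n, 0 < n → p n) ↔ ZeroDivisorPrimeCondition R :=
    ⟨fun hp => (h 1 one_pos).mp (hp 1 one_pos), fun hR n hn => (h n hn).mpr hR⟩
  -- Every entry of the list is rewritten to the same proposition, condition 9 for `R`.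
  rw [← zeroDivisorPrimeCondition_iff, ediam_annihilatingIdealGraph_eq_two_iff fun _ => hK2,
    ediam_zeroDivisorGraph_eq_two_iff fun _ => hK2,
    ediam_annihilatingIdealGraph_eq_two_iff not_nonempty_iso_polynomial,
    ediam_zeroDivisorGraph_eq_two_iff not_nonempty_iso_polynomial,
    ediam_annihilatingIdealGraph_eq_two_iff not_nonempty_iso_powerSeries,
    ediam_zeroDivisorGraph_eq_two_iff not_nonempty_iso_powerSeries,
    zeroDivisorPrimeCondition_polynomial_iff, zeroDivisorPrimeCondition_powerSeries_iff,
    hforall fun n hn => (ediam_annihilatingIdealGraph_eq_two_iff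
      (not_nonempty_iso_mvPolynomial hn)).trans (zeroDivisorPrimeCondition_mvPolynomial_iff n),
    hforall fun n hn => (ediam_zeroDivisorGraph_eq_two_iff
      (not_nonempty_iso_mvPolynomial hn)).trans (zeroDivisorPrimeCondition_mvPolynomial_iff n)]
  simp
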